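/- Let $n\ge 2$ firms with common unit cost $c\in\mathbb R$ repeatedly compete in prices taken from a common grid $a^1<\dots<a^M$ ($M\ge1$). In the stage game firm $i$ has utility $u_i(a)=d_i(a)\,(a_i-c)$, where the demand is either * *standard:* $d_i(a)=\frac{D}{n_{\min}}(1-a_i)$ if $a_i=\min_j a_j$ and $d_i(a)=0$ otherwise, where $n_{\min}$ is the number of firms with the lowest price, $D>0$, $c<a^1$, $a^M\le 1$, and $a^{k-1}-(a^k-a^{k-1})\ge c$ for $2\le k\le M$; or * *linear:* $d_i(a)=\alpha-\beta a_i+\frac{\gamma}{n-1}\sum_{j\ne i}a_j$ with $\beta>\gamma>0$, $0\le a^1$, and $a^{k^*}\le p^*<a^{k^*+1}$ for some $1\le k^*<M$, where $p^*=\frac{\alpha+\beta c}{2\beta-\gamma}$. *Repeated play.* In rounds $t=1,2,\dots$ the profile $a_t=(a_{1,t},\dots,a_{n,t})$ is played. Let $H_{t-1}$ be the history of all players (past actions and payoffs) before round $t$. Payoffs may be random: $U_{i,t}(a)$ takes values in a fixed bounded interval, has mean $u_i(a)$, and is independent of $(H_{t-1},a_t)$ (deterministic payoffs $U_{i,t}=u_i$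 are a special case). Player $i$ may have entered $\delta_i\ge0$ rounds before round $1$, with bounded rewards $\tilde u_{i,r}(a)$, $1\le r\le \delta_i$, in those rounds, which are part of the history. The average reward of price $a$ for player $i$ before round $t$ is $$\alpha_{i,t}(a)=\frac{1}{\delta_i+t-1}\Big(\sum_{r=1}^{\delta_i}\tilde u_{i,r}(a)+\sum_{s=1}^{t-1}U_{i,s}(a,a_{-i,s})\Big).$$ Let $x_{i,t}(a)=\mathbb P(a_{i,t}=a\mid H_{t-1})$. Player $i$ is *mean-based* if there is a non-increasing sequence $\gamma_{i,t}\to0$ such that, almost surely, for all $t,a,a'$: if $\alpha_{i,t}(a')-\alpha_{i,t}(a)>\gamma_{i,\delta_i+t}$ then $x_{i,t}(a)\le\gamma_{i,\delta_i+t}$. The play *converges in time-average* to a set $S$ of prices if $\frac1T\sum_{t=1}^T\mathbb I[\forall i:\ a_{i,t}\in S]\to1$. **Theorem.** Assume that all players are mean-based. 1. *Standard demand.* The profile in which all firms play $a^1$ is the unique (pure or mixed) Nash equilibrium of the grid game, and almost surely the play converges in time-average to $\{a^1\}$ and $x_{i,t}\to\mathbf 1_{a^1}$ for every $i$ (last-iterate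 convergence). 2. *Linear demand.* The profile in which all firms play $p^*$ is the unique pure Nash equilibrium of the game with continuous prices in $[0,\infty)$. In the grid game at least one of the two symmetric profiles in which all firms play $a^{k^*}$, respectively all play $a^{k^*+1}$, is a Nash equilibrium, and every (pure or mixed) Nash equilibrium is supported on prices in $\{a^{k^*},a^{k^*+1}\}$. Almost surely the play converges in time-average to $\{a^{k^*},a^{k^*+1}\}$, and $x_{i,t}(a)\to0$ for every $i$ and every $a\notin\{a^{k^*},a^{k^*+1}\}$. -/

import Mathlib

open MeasureTheory ProbabilityTheory Filter Topology

noncomputable section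

/-! ### Finite normal-form games (common action set `A`) and Nash equilibria -/

/-- Expected utility of player `i` when the players randomise independently, player `j`
according to the probability vector `x j`. -/
def expectedUtility {n : ℕ} {A : Type*} [Fintype A]
    (u : Fin n → (Fin n → A) → ℝ) (i : Fin n) (x : Fin n → A → ℝ) : ℝ :=
  ∑ s : Fin n → A, (∏ j, x j (s j)) * u i s

/-- `x` is a (possibly mixed) Nash equilibrium of the finite game with utilities `u`. -/
def IsNashEquilibrium {n : ℕ} {A : Type*} [Fintype A]
    (u : Fin n → (Fin n → A) → ℝ) (x : Fin n → A → ℝ) : Prop :=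
  (∀ i, x i ∈ stdSimplex ℝ A) ∧
    ∀ i, ∀ y ∈ stdSimplex ℝ A,
      expectedUtility u i (Function.update x i y) ≤ expectedUtility u i x

/-- The mixed strategy profile in which every player plays the action `a` with probability one. -/
def symmetricPureProfile (n : ℕ) {A : Type*} [DecidableEq A] (a : A) : Fin n → A → ℝ :=
  fun _ => Pi.single a 1

/-- `a` is a pure Nash equilibrium of the game in which every player picks a real number
from the set `S`. -/
def IsPureNashOn {n : ℕ} (S : Set ℝ) (u : Fin n → (Fin n → ℝ) → ℝ) (a : Fin n → ℝ) : Prop :=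
  (∀ i, a i ∈ S) ∧ ∀ i, ∀ b ∈ S, u i (Function.update a i b) ≤ u i a

/-! ### Symmetric Bertrand competition -/

/-- Standard (all-or-nothing) demand: the firms with the lowest price share the demand
`D * (1 - price)` equally. -/
def standardDemand {n : ℕ} (D : ℝ) (i : Fin n) (a : Fin n → ℝ) : ℝ :=
  if ∀ j, a i ≤ a j then
    D / ((Finset.univ.filter fun j => ∀ k, a j ≤ a k).card : ℝ) * (1 - a i)
  else 0

/-- Linear demand. -/
def linearDemand {n : ℕ} (α β γ : ℝ) (i : Fin n) (a : Fin n → ℝ) : ℝ :=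
  α - β * a i + γ / ((n : ℝ) - 1) * ∑ j ∈ Finset.univ.erase i, a j

/-- The profit of firm `i` with unit cost `c` under the demand functions `d`. -/
def bertrandUtility {n : ℕ} (d : Fin n → (Fin n → ℝ) → ℝ) (c : ℝ) (i : Fin n)
    (a : Fin n → ℝ) : ℝ :=
  d i a * (a i - c)

/-- The finite game obtained by restricting all prices to the grid `p 0, …, p m`; an action is
the index of a grid point. -/
def gridUtility {n m : ℕ} (p : Fin (m + 1) → ℝ) (u : Fin n → (Fin n → ℝ) → ℝ) (i : Fin n)
    (s : Fin n → Fin (m + 1)) : ℝ :=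
  u i (fun j => p (s j))

/-- The equilibrium price of symmetric linear Bertrand competition with continuous prices. -/
def continuousNashPrice (α β γ c : ℝ) : ℝ := (α + β * c) / (2 * β - γ)

/-! ### Repeated play and mean-based learning

Rounds are numbered by `t = 0, 1, 2, …`. The σ-algebra `ℱ t` is the history available before the
actions of round `t` are chosen; `act t ω i` is the action of player `i` in round `t`, and
`U t i s ω` is the (possibly random) payoff of player `i` in round `t` if the profile `s` is
played. Player `i` entered `d i` rounds before round `0`, and `pre i r a ω`, `r < d i`, is the
reward that action `a` would have given in the `r`-th of those earlier rounds. -/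

/-- The game with utilities `u` is played repeatedly: actions and payoffs are recorded in the
history, payoffs are bounded, have mean `u`, and are drawn by nature independently of the past
history and of the current actions; the rewards before round `0` are bounded. -/
structure IsRepeatedPlay {Ω : Type*} [mΩ : MeasurableSpace Ω] (P : Measure Ω)
    (ℱ : Filtration ℕ mΩ) {n : ℕ} {A : Type*} [MeasurableSpace A]
    (u : Fin n → (Fin n → A) → ℝ) (U : ℕ → Fin n → (Fin n → A) → Ω → ℝ)
    (d : Fin n → ℕ) (pre : Fin n → ℕ → A → Ω → ℝ) (act : ℕ → Ω → Fin n → A) : Prop where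
  measurable_act : ∀ t, Measurable[ℱ (t + 1)] (act t)
  measurable_payoff : ∀ t i s, Measurable[ℱ (t + 1)] (U t i s)
  bounded_payoff : ∃ lo hi : ℝ, ∀ t i s ω, U t i s ω ∈ Set.Icc lo hi
  mean_payoff : ∀ t i s, ∫ ω, U t i s ω ∂P = u i s
  indep_payoff : ∀ t i s, Indep (MeasurableSpace.comap (U t i s) inferInstance)
    (ℱ t ⊔ MeasurableSpace.comap (act t) inferInstance) P
  measurable_pre : ∀ i, ∀ r < d i, ∀ a, Measurable[ℱ 0] (pre i r a)
  bounded_pre : ∃ C : ℝ, ∀ i, ∀ r < d i, ∀ a ω, |pre i r a ω| ≤ C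

/-- The average reward of action `a` for player `i` over all rounds before round `t`, including
the `d i` rounds before round `0`, against the actions the opponents actually played. -/
def averageReward {Ω : Type*} {n : ℕ} {A : Type*}
    (U : ℕ → Fin n → (Fin n → A) → Ω → ℝ) (d : Fin n → ℕ) (pre : Fin n → ℕ → A → Ω → ℝ)
    (act : ℕ → Ω → Fin n → A) (i : Fin n) (t : ℕ) (a : A) (ω : Ω) : ℝ :=
  (∑ r ∈ Finset.range (d i), pre i r a ω +
      ∑ s ∈ Finset.range t, U s i (Function.update (act s ω) i a) ω) / ((d i : ℝ) + (t : ℝ))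

/-- The probability, given the history before round `t`, that player `i` picks `a` in round `t`;
as a function of `a` this is the mixed strategy used by player `i` in round `t`. -/
def mixedStrategy {Ω : Type*} [mΩ : MeasurableSpace Ω] (P : Measure Ω)
    (ℱ : Filtration ℕ mΩ) {n : ℕ} {A : Type*} (act : ℕ → Ω → Fin n → A)
    (t : ℕ) (i : Fin n) (a : A) : Ω → ℝ :=
  P[Set.indicator {ω | act t ω i = a} (fun _ => (1 : ℝ)) | ℱ t]

/-- Player `i` is mean-based: there is a non-increasing null sequence `g` such that an action
whose average reward so far is more than `g` below that of another action is picked with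
conditional probability at most `g`. (Round `t` is round number `d i + t` of player `i`.) -/
def IsMeanBased {Ω : Type*} [mΩ : MeasurableSpace Ω] (P : Measure Ω)
    (ℱ : Filtration ℕ mΩ) {n : ℕ} {A : Type*}
    (U : ℕ → Fin n → (Fin n → A) → Ω → ℝ) (d : Fin n → ℕ) (pre : Fin n → ℕ → A → Ω → ℝ)
    (act : ℕ → Ω → Fin n → A) (i : Fin n) : Prop :=
  ∃ g : ℕ → ℝ, Antitone g ∧ Tendsto g atTop (𝓝 0) ∧
    ∀ t a a', ∀ᵐ ω ∂P,
      g (d i + t) < averageReward U d pre act i t a' ω - averageReward U d pre act i t a ω →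
        mixedStrategy P ℱ act t i a ω ≤ g (d i + t)

/-- The sequence of action profiles `s` converges in time-average to the set of profiles all of
whose components lie in `S`. -/
def TimeAverageConverges {n : ℕ} {A : Type*} (s : ℕ → Fin n → A) (S : Set A) : Prop :=
  Tendsto
    (fun T : ℕ =>
      (∑ t ∈ Finset.range T, Set.indicator {b : Fin n → A | ∀ i, b i ∈ S} (fun _ => (1 : ℝ)) (s t))
        / (T : ℝ))
    atTop (𝓝 1)

end

/-! Iterated elimination of strictly dominated prices settles equilibria and learning alike: a Nash
equilibrium puts no mass on an eliminated price (`IteratedElimination.nash_support`), and mean-based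
players stop choosing it (`IteratedElimination.ae_tendsto_mixedStrategy`).

Learning is handled by induction over the eliminations. If actions outside `S` have probability
tending to zero, a law of large numbers keeps the realised play in `S` for asymptotically all
rounds. Against such play, a mixture dominating `b` on `S` earns more than `b` on average by a fixed
margin. Average rewards inherit part of this margin, since payoff noise and entry rewards average
out. The thresholds of the players tend to zero, so some pure action eventually beats `b` by more
than the threshold, which forces the probability of `b` to zero.

With standard demand the highest remaining price is dominated. If all opponents charge it,
undercutting by one grid step wins the whole market, and the gap condition makes this pay. If some
opponent is lower, the highest price sells nothing while the lowest grid price still earns. A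
mixture of these two answers covers both cases, and only the lowest price survives.

With linear demand profit is a concave quadratic in the own price, maximal at a weighted mean of the
continuous equilibrium price and the competitors' mean price. So an extreme grid price is dominated
by its inner neighbour until only the two prices around the continuous equilibrium remain. -/

/-! ### Iterated elimination of strictly dominated actions -/

/-- The action `b` of player `i` is strictly dominated by a mixed action as long as the
opponents use actions in `S` only. -/
def IsStrictlyDominated {n : ℕ} {A : Type*} [Fintype A]
    (u : Fin n → (Fin n → A) → ℝ) (S : Set A) (i : Fin n) (b : A) : Prop :=
  ∃ w ∈ stdSimplex ℝ A, ∀ s : Fin n → A, (∀ j, j ≠ i → s j ∈ S) →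
    u i (Function.update s i b) < ∑ a, w a * u i (Function.update s i a)

/-- `S` arises from the set of all actions by successively removing actions that are strictly
dominated for all players. -/
inductive IteratedElimination {n : ℕ} {A : Type*} [Fintype A]
    (u : Fin n → (Fin n → A) → ℝ) : Set A → Prop
  | univ : IteratedElimination u Set.univ
  | step {S : Set A} {b : A} (hS : IteratedElimination u S)
      (hb : ∀ i, IsStrictlyDominated u S i b) : IteratedElimination u (S \ {b})

theorem IsStrictlyDominated.of_pure {n : ℕ} {A : Type*} [Fintype A] [DecidableEq A]
    {u : Fin n → (Fin n → A) → ℝ} {S : Set A} {i : Fin n} {b : A} (a : A)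
    (h : ∀ s : Fin n → A, (∀ j, j ≠ i → s j ∈ S) →
      u i (Function.update s i b) < u i (Function.update s i a)) :
    IsStrictlyDominated u S i b := by
  refine ⟨Pi.single a 1, single_mem_stdSimplex ℝ a, fun s hs => ?_⟩
  simpa [Pi.single_apply] using h s hs

/-! ### Expected payoffs and Nash equilibria -/

/-- The expected utility of player `i` when playing the pure action `a` against `x`. -/
noncomputable def expectedPayoff {n : ℕ} {A : Type*} [Fintype A]
    (u : Fin n → (Fin n → A) → ℝ) (i : Fin n) (x : Fin n → A → ℝ) (a : A) : ℝ :=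
  ∑ r : {j // j ≠ i} → A, (∏ j : {j // j ≠ i}, x j (r j)) * u i ((Equiv.funSplitAt i A).symm (a, r))

theorem expectedUtility_update {n : ℕ} {A : Type*} [Fintype A]
    (u : Fin n → (Fin n → A) → ℝ) (i : Fin n) (x : Fin n → A → ℝ) (y : A → ℝ) :
    expectedUtility u i (Function.update x i y) = ∑ a, y a * expectedPayoff u i x a := by
  unfold expectedUtility expectedPayoff
  rw [← (Equiv.funSplitAt i A).symm.sum_comp, Fintype.sum_prod_type]
  refine Finset.sum_congr rfl fun a _ => ?_
  rw [Finset.mul_sum]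
  refine Finset.sum_congr rfl fun r _ => ?_
  rw [← mul_assoc]
  congr 1
  rw [← Finset.mul_prod_erase _ _ (Finset.mem_univ i)]
  congr 1
  · simp
  · rw [Finset.prod_subtype (Finset.univ.erase i) (p := fun j => j ≠ i) (by simp)]
    refine Fintype.prod_congr _ _ fun j => ?_
    simp [j.2]

theorem expectedUtility_eq {n : ℕ} {A : Type*} [Fintype A]
    (u : Fin n → (Fin n → A) → ℝ) (i : Fin n) (x : Fin n → A → ℝ) :
    expectedUtility u i x = ∑ a, x i a * expectedPayoff u i x a := by
  conv_lhs => rw [← Function.update_eq_self i x]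
  exact expectedUtility_update u i x (x i)

theorem funSplitAt_symm_eq_update {n : ℕ} {A : Type*} (i : Fin n) (a b : A)
    (r : {j // j ≠ i} → A) :
    (Equiv.funSplitAt i A).symm (a, r) =
      Function.update ((Equiv.funSplitAt i A).symm (b, r)) i a := by
  funext j
  by_cases h : j = i
  · subst h; simp
  · simp [h]

/-- Average the pointwise domination over the opponents' profiles: those leaving `S` have weight
zero, and since the weights sum to one, some profile has positive weight and gives strictness. -/
theorem IsStrictlyDominated.expectedPayoff_lt {n : ℕ} {A : Type*} [Fintype A]
    {u : Fin n → (Fin n → A) → ℝ} {S : Set A} {i : Fin n} {b : A}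
    {x : Fin n → A → ℝ} (hx : ∀ j, x j ∈ stdSimplex ℝ A)
    (hS : ∀ j a, a ∉ S → x j a = 0)
    {w : A → ℝ}
    (h : ∀ s : Fin n → A, (∀ j, j ≠ i → s j ∈ S) →
      u i (Function.update s i b) < ∑ a, w a * u i (Function.update s i a)) :
    expectedPayoff u i x b < ∑ a, w a * expectedPayoff u i x a := by
  have key : ∑ a, w a * expectedPayoff u i x a =
      ∑ r : {j // j ≠ i} → A, (∏ j : {j // j ≠ i}, x j (r j)) *
        ∑ a, w a * u i ((Equiv.funSplitAt i A).symm (a, r)) := by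
    unfold expectedPayoff
    simp_rw [Finset.mul_sum]
    rw [Finset.sum_comm]
    exact Finset.sum_congr rfl fun r _ => Finset.sum_congr rfl fun a _ => by ring
  have hone : ∑ r : {j // j ≠ i} → A, ∏ j : {j // j ≠ i}, x j (r j) = 1 := by
    rw [← Fintype.piFinset_univ, ← Finset.prod_univ_sum]
    exact Finset.prod_eq_one fun j _ => (hx j).2
  have hnn : ∀ r : {j // j ≠ i} → A, 0 ≤ ∏ j : {j // j ≠ i}, x j (r j) :=
    fun r => Finset.prod_nonneg fun j _ => (hx j).1 _
  have hlt : ∀ r : {j // j ≠ i} → A, ∏ j : {j // j ≠ i}, x j (r j) ≠ 0 →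
      u i ((Equiv.funSplitAt i A).symm (b, r)) <
        ∑ a, w a * u i ((Equiv.funSplitAt i A).symm (a, r)) := by
    intro r hr
    have := h ((Equiv.funSplitAt i A).symm (b, r)) fun j hj => by
      by_contra hjS
      refine hr (Finset.prod_eq_zero (Finset.mem_univ (⟨j, hj⟩ : {j // j ≠ i})) (hS _ _ ?_))
      simpa [hj] using hjS
    simp_rw [← funSplitAt_symm_eq_update] at this
    exact this
  obtain ⟨r, -, hr⟩ : ∃ r ∈ (Finset.univ : Finset ({j // j ≠ i} → A)),
      ∏ j : {j // j ≠ i}, x j (r j) ≠ 0 :=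
    Finset.exists_ne_zero_of_sum_ne_zero (by rw [hone]; exact one_ne_zero)
  rw [key]
  refine Finset.sum_lt_sum (fun r _ => ?_) ⟨r, Finset.mem_univ _, ?_⟩
  · by_cases h0 : ∏ j : {j // j ≠ i}, x j (r j) = 0
    · simp [h0]
    · exact mul_le_mul_of_nonneg_left (hlt r h0).le (hnn r)
  · exact mul_lt_mul_of_pos_left (hlt r hr) ((hnn r).lt_of_ne' hr)

/-- Shifting the mass `x i b` from `b` to the dominating mixture changes the payoff by `x i b` times
a positive number, so an equilibrium has no such mass to shift. -/
theorem IsNashEquilibrium.eq_zero_of_isStrictlyDominated {n : ℕ} {A : Type*} [Fintype A]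
    {u : Fin n → (Fin n → A) → ℝ} {S : Set A} {i : Fin n} {b : A}
    {x : Fin n → A → ℝ} (hx : IsNashEquilibrium u x) (hS : ∀ j a, a ∉ S → x j a = 0)
    (h : IsStrictlyDominated u S i b) : x i b = 0 := by
  classical
  obtain ⟨w, hw, hdom⟩ := h
  have hlt := IsStrictlyDominated.expectedPayoff_lt hx.1 hS hdom
  by_contra hne
  have hpos : 0 < x i b := ((hx.1 i).1 b).lt_of_ne' hne
  let y : A → ℝ := fun a => x i a + x i b * (w a - (Pi.single b 1 : A → ℝ) a)
  have hy : y ∈ stdSimplex ℝ A := by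
    refine ⟨fun a => ?_, ?_⟩
    · have h1 := (hx.1 i).1 a
      have h2 := mul_nonneg hpos.le (hw.1 a)
      by_cases hab : a = b
      · subst hab; simp only [y, Pi.single_eq_same]; linarith
      · simp only [y, Pi.single_eq_of_ne hab]; linarith
    · simp only [y, Finset.sum_add_distrib, ← Finset.mul_sum, Finset.sum_sub_distrib, hw.2,
        (hx.1 i).2, Finset.sum_pi_single']
      simp
  have hdev := hx.2 i y hy
  rw [expectedUtility_update, expectedUtility_eq u i x] at hdev
  have : ∑ a, y a * expectedPayoff u i x a = ∑ a, x i a * expectedPayoff u i x a +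
      x i b * (∑ a, w a * expectedPayoff u i x a - expectedPayoff u i x b) := by
    have hb : expectedPayoff u i x b = ∑ a, (Pi.single b 1 : A → ℝ) a * expectedPayoff u i x a := by
      simp [Pi.single_apply]
    rw [hb, ← Finset.sum_sub_distrib, Finset.mul_sum, ← Finset.sum_add_distrib]
    exact Finset.sum_congr rfl fun a _ => by simp only [y]; ring
  rw [this] at hdev
  nlinarith [mul_pos hpos (sub_pos.2 hlt)]

/-- Nash equilibria are supported on the actions surviving iterated elimination. -/
theorem IteratedElimination.nash_support {n : ℕ} {A : Type*} [Fintype A]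
    {u : Fin n → (Fin n → A) → ℝ} {S : Set A} (hS : IteratedElimination u S)
    {x : Fin n → A → ℝ} (hx : IsNashEquilibrium u x) :
    ∀ i a, a ∉ S → x i a = 0 := by
  induction hS with
  | univ => exact fun i a h => absurd (Set.mem_univ a) h
  | @step S b _ hb ih =>
    intro i a ha
    by_cases haS : a ∈ S
    · obtain rfl : a = b := by simpa [haS] using ha
      exact hx.eq_zero_of_isStrictlyDominated ih (hb i)
    · exact ih i a haS

/-- Payoffs are linear in a player's own mixture, so pure deviations are enough. -/
theorem isNashEquilibrium_symmetricPureProfile {n : ℕ} {A : Type*} [Fintype A] [DecidableEq A]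
    {u : Fin n → (Fin n → A) → ℝ} {a : A}
    (h : ∀ i b, u i (Function.update (fun _ => a) i b) ≤ u i fun _ => a) :
    IsNashEquilibrium u (symmetricPureProfile n a) := by
  refine ⟨fun i => single_mem_stdSimplex ℝ a, fun i y hy => ?_⟩
  have hV : ∀ b, expectedPayoff u i (symmetricPureProfile n a) b =
      u i (Function.update (fun _ => a) i b) := by
    intro b
    unfold expectedPayoff symmetricPureProfile
    rw [Finset.sum_eq_single (fun _ => a)]
    · simp only [Pi.single_eq_same, Finset.prod_const_one, one_mul]
      congr 1
    · intro r _ hr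
      obtain ⟨j, hj⟩ := Function.ne_iff.1 hr
      rw [Finset.prod_eq_zero (Finset.mem_univ j) (by exact Pi.single_eq_of_ne hj 1), zero_mul]
    · simp
  rw [expectedUtility_update, expectedUtility_eq]
  simp_rw [hV]
  have : ∑ b, symmetricPureProfile n a i b * u i (Function.update (fun _ => a) i b) =
      u i fun _ => a := by
    simp [symmetricPureProfile, Pi.single_apply]
  rw [this]
  calc ∑ b, y b * u i (Function.update (fun _ => a) i b)
      ≤ ∑ b, y b * u i fun _ => a :=
        Finset.sum_le_sum fun b _ => mul_le_mul_of_nonneg_left (h i b) (hy.1 b)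
    _ = u i fun _ => a := by rw [← Finset.sum_mul, hy.2, one_mul]

/-! ### Elimination from the ends of a grid -/

theorem IsStrictlyDominated.mono {n : ℕ} {A : Type*} [Fintype A]
    {u : Fin n → (Fin n → A) → ℝ} {S T : Set A} {i : Fin n} {b : A}
    (h : IsStrictlyDominated u T i b) (hST : S ⊆ T) : IsStrictlyDominated u S i b :=
  let ⟨w, hw, hdom⟩ := h
  ⟨w, hw, fun s hs => hdom s fun j hj => hST (hs j hj)⟩

theorem IteratedElimination.Iic {n m : ℕ} {u : Fin n → (Fin n → Fin (m + 1)) → ℝ}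
    (k : Fin (m + 1))
    (h : ∀ j : Fin m, k ≤ j.castSucc → ∀ i, IsStrictlyDominated u (Set.Iic j.succ) i j.succ) :
    IteratedElimination u (Set.Iic k) := by
  suffices H : ∀ l, k ≤ l → IteratedElimination u (Set.Iic l) from H k le_rfl
  intro l
  induction l using Fin.reverseInduction with
  | last =>
    intro _
    have : Set.Iic (Fin.last m) = Set.univ := Set.Iic_top
    exact this ▸ .univ
  | cast j ih =>
    intro hj
    have := (ih (hj.trans (Fin.castSucc_lt_succ).le)).step (h j hj)
    convert this using 1
    ext a
    simp only [Set.mem_Iic, Set.mem_sdiff, Set.mem_singleton_iff, Fin.le_def, Fin.ext_iff,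
      Fin.val_castSucc, Fin.val_succ]
    omega

/-- Domination is asked against the whole of `Set.Ici j.castSucc`, which contains the surviving
interval. The removals from below are thus independent of how far the top was cut. -/
theorem IteratedElimination.Icc {n m : ℕ} {u : Fin n → (Fin n → Fin (m + 1)) → ℝ}
    {k r : Fin (m + 1)} (hr : IteratedElimination u (Set.Iic r))
    (h : ∀ j : Fin m, j.succ ≤ k → ∀ i, IsStrictlyDominated u (Set.Ici j.castSucc) i j.castSucc) :
    IteratedElimination u (Set.Icc k r) := by
  suffices H : ∀ l, l ≤ k → IteratedElimination u (Set.Icc l r) from H k le_rfl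
  intro l
  induction l using Fin.induction with
  | zero =>
    intro _
    have : Set.Icc 0 r = Set.Iic r := Set.Icc_bot
    rwa [this]
  | succ j ih =>
    intro hj
    have := (ih ((Fin.castSucc_lt_succ).le.trans hj)).step
      fun i => (h j hj i).mono Set.Icc_subset_Ici_self
    convert this using 1
    ext a
    simp only [Set.mem_Icc, Set.mem_sdiff, Set.mem_singleton_iff, Fin.le_def, Fin.ext_iff,
      Fin.val_castSucc, Fin.val_succ] at *
    omega

/-! ### Standard demand -/

section Standard

variable {n : ℕ} {D : ℝ} {i : Fin n} {a : Fin n → ℝ}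

theorem standardDemand_nonneg (hD : 0 ≤ D) (h : a i ≤ 1) : 0 ≤ standardDemand D i a := by
  unfold standardDemand
  split_ifs
  · exact mul_nonneg (by positivity) (sub_nonneg.2 h)
  · exact le_rfl

theorem standardDemand_eq_zero {j : Fin n} (h : a j < a i) : standardDemand D i a = 0 :=
  if_neg fun h' => (h' j).not_gt h

theorem standardDemand_pos (hD : 0 < D) (h : a i < 1) (hmin : ∀ j, a i ≤ a j) :
    0 < standardDemand D i a := by
  rw [standardDemand, if_pos hmin]
  have : 0 < (Finset.univ.filter fun j => ∀ k, a j ≤ a k).card :=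
    Finset.card_pos.2 ⟨i, by simpa using hmin⟩
  exact mul_pos (by positivity) (sub_pos.2 h)

theorem standardDemand_eq_of_lt (h : ∀ j, j ≠ i → a i < a j) :
    standardDemand D i a = D * (1 - a i) := by
  have hmin : ∀ j, a i ≤ a j := fun j => by
    rcases eq_or_ne j i with rfl | hj
    · exact le_rfl
    · exact (h j hj).le
  have : (Finset.univ.filter fun j => ∀ k, a j ≤ a k) = {i} := by
    ext j
    simp only [Finset.mem_filter, Finset.mem_univ, true_and, Finset.mem_singleton]
    refine ⟨fun hj => ?_, fun hj => hj ▸ hmin⟩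
    by_contra hne
    exact (hj i).not_gt (h j hne)
  rw [standardDemand, if_pos hmin, this]
  simp

theorem standardDemand_le_half (hD : 0 ≤ D) (h : a i ≤ 1) {j : Fin n} (hj : j ≠ i)
    (hji : a j ≤ a i) : standardDemand D i a ≤ D / 2 * (1 - a i) := by
  unfold standardDemand
  split_ifs with hmin
  · refine mul_le_mul_of_nonneg_right ?_ (sub_nonneg.2 h)
    have : 2 ≤ (Finset.univ.filter fun j => ∀ k, a j ≤ a k).card := by
      rw [← Finset.card_pair hj]
      refine Finset.card_le_card fun l hl => ?_
      simp only [Finset.mem_insert, Finset.mem_singleton] at hl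
      rcases hl with rfl | rfl
      · simpa using fun k => hji.trans (hmin k)
      · simpa using hmin
    exact div_le_div_of_nonneg_left hD two_pos (by exact_mod_cast this)
  · exact mul_nonneg (by positivity) (sub_nonneg.2 h)

end Standard

theorem gridUtility_standard_nonneg {n m : ℕ} {p : Fin (m + 1) → ℝ} (hp : StrictMono p)
    {c D : ℝ} (hD : 0 < D) (hc : c < p 0) (h1 : p (Fin.last m) ≤ 1) (i : Fin n)
    (s : Fin n → Fin (m + 1)) :
    0 ≤ gridUtility p (bertrandUtility (standardDemand D) c) i s := by
  have h2 : p (s i) ≤ 1 := (hp.monotone (Fin.le_last _)).trans h1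
  have h3 : c < p (s i) := hc.trans_le (hp.monotone (Fin.zero_le _))
  exact mul_nonneg (standardDemand_nonneg hD.le h2) (sub_nonneg.2 h3.le)

/-- Against opponents that price at most at a grid point, that grid point is dominated by
a mixture of the next lower grid point and the lowest one. -/
theorem isStrictlyDominated_standard {n m : ℕ} (hn : 2 ≤ n) {p : Fin (m + 1) → ℝ}
    (hp : StrictMono p) {c D : ℝ} (hD : 0 < D) (hc : c < p 0) (h1 : p (Fin.last m) ≤ 1)
    (k : Fin m) (hk : c ≤ p k.castSucc - (p k.succ - p k.castSucc)) (i : Fin n) :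
    IsStrictlyDominated (gridUtility p (bertrandUtility (standardDemand D) c))
      (Set.Iic k.succ) i k.succ := by
  set u := gridUtility (n := n) p (bertrandUtility (standardDemand D) c) with hu
  have hlt : p k.castSucc < p k.succ := hp Fin.castSucc_lt_succ
  have hk1 : p k.succ ≤ 1 := (hp.monotone (Fin.le_last _)).trans h1
  have hck : c < p k.castSucc := hc.trans_le (hp.monotone (Fin.zero_le _))
  set V := D * (1 - p k.castSucc) * (p k.castSucc - c) with hV
  set W := D / 2 * (1 - p k.succ) * (p k.succ - c) with hW
  have hW0 : 0 ≤ W := by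
    have := hck.trans hlt
    exact mul_nonneg (mul_nonneg (by positivity) (by linarith)) (by linarith)
  have hVW : W < V := by
    -- The gap condition says that the margin at the higher price is at most twice the margin one
    -- step below, which offsets the factor one half lost by sharing the market.
    have e1 : W ≤ D * (1 - p k.succ) * (p k.castSucc - c) := by
      have : 0 ≤ D * (1 - p k.succ) := mul_nonneg hD.le (by linarith)
      rw [hW]
      nlinarith
    have e2 : D * (1 - p k.succ) * (p k.castSucc - c) < V :=
      mul_lt_mul_of_pos_right (mul_lt_mul_of_pos_left (by linarith) hD) (by linarith)
    exact e1.trans_lt e2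
  have hV0 : 0 < V := hW0.trans_lt hVW
  have hunn : ∀ s, 0 ≤ u i s := gridUtility_standard_nonneg hp hD hc h1 i
  -- With this weight `(1 - θ) * V` is the midpoint of `V` and `W`, still above `W`, while the
  -- lowest price keeps a positive weight.
  set θ : ℝ := (V - W) / (2 * V) with hθ
  have hθ0 : 0 < θ := div_pos (by linarith) (by linarith)
  have hθ1 : θ ≤ 1 := (div_le_one (by linarith)).2 (by linarith)
  have hθV : θ * V = (V - W) / 2 := by rw [hθ]; field_simp
  refine ⟨(1 - θ) • Pi.single k.castSucc 1 + θ • Pi.single 0 1,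
    convex_stdSimplex ℝ _ (single_mem_stdSimplex ℝ _) (single_mem_stdSimplex ℝ _)
      (by linarith) hθ0.le (by ring), fun s hs => ?_⟩
  have hsum : ∑ b, ((1 - θ) • Pi.single k.castSucc 1 + θ • Pi.single 0 1 : Fin (m + 1) → ℝ) b *
      u i (Function.update s i b) = (1 - θ) * u i (Function.update s i k.castSucc) +
        θ * u i (Function.update s i 0) := by
    simp [add_mul, Finset.sum_add_distrib, Pi.single_apply]
  rw [hsum]
  have : Nontrivial (Fin n) := Fin.nontrivial_iff_two_le.2 hn
  by_cases hall : ∀ j, j ≠ i → s j = k.succ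
  · have h2 : u i (Function.update s i k.castSucc) = V := by
      simp only [hu, gridUtility, bertrandUtility, Function.update_self]
      rw [standardDemand_eq_of_lt fun j hj => ?_]
      · simp [hV]
      · simp [Function.update_of_ne hj, hall j hj, hlt]
    have h3 : u i (Function.update s i k.succ) ≤ W := by
      simp only [hu, gridUtility, bertrandUtility, Function.update_self]
      obtain ⟨j, hj⟩ := exists_ne i
      refine (mul_le_mul_of_nonneg_right (standardDemand_le_half hD.le ?_ hj ?_)
        (by linarith)).trans_eq ?_
      · simpa using hk1
      · simp [Function.update_of_ne hj, hall j hj]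
      · simp [hW]
    have h4 := mul_nonneg hθ0.le (hunn (Function.update s i 0))
    rw [h2]
    linarith
  · push Not at hall
    obtain ⟨j, hj, hjk⟩ := hall
    have hlt' : s j < k.succ := lt_of_le_of_ne (hs j hj) hjk
    have h2 : u i (Function.update s i k.succ) = 0 := by
      simp only [hu, gridUtility, bertrandUtility]
      rw [standardDemand_eq_zero (j := j), zero_mul]
      simpa [Function.update_of_ne hj] using hp hlt'
    have h3 : 0 < u i (Function.update s i 0) := by
      simp only [hu, gridUtility, bertrandUtility]
      refine mul_pos (standardDemand_pos hD ?_ fun j => ?_) ?_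
      · simpa using (hp (Fin.succ_pos k)).trans_le hk1
      · simpa using hp.monotone (Fin.zero_le _)
      · simpa using hc
    rw [h2]
    have h4 := mul_nonneg (sub_nonneg.2 hθ1) (hunn (Function.update s i k.castSucc))
    have h5 := mul_pos hθ0 h3
    linarith

theorem iteratedElimination_standard {n m : ℕ} (hn : 2 ≤ n) {p : Fin (m + 1) → ℝ}
    (hp : StrictMono p) {c D : ℝ} (hD : 0 < D) (hc : c < p 0) (h1 : p (Fin.last m) ≤ 1)
    (hk : ∀ k : Fin m, c ≤ p k.castSucc - (p k.succ - p k.castSucc)) :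
    IteratedElimination (gridUtility (n := n) p (bertrandUtility (standardDemand D) c)) {0} := by
  have := IteratedElimination.Iic (u := gridUtility (n := n) p
    (bertrandUtility (standardDemand D) c)) 0
    fun j _ i => isStrictlyDominated_standard hn hp hD hc h1 j (hk j) i
  rwa [show Set.Iic (0 : Fin (m + 1)) = {0} from Set.Iic_bot] at this

/-- Raising the price alone leaves the whole demand to the other firms, whereas profits on the grid
are never negative. -/
theorem isNashEquilibrium_standard {n m : ℕ} (hn : 2 ≤ n) {p : Fin (m + 1) → ℝ}
    (hp : StrictMono p) {c D : ℝ} (hD : 0 < D) (hc : c < p 0) (h1 : p (Fin.last m) ≤ 1) :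
    IsNashEquilibrium (gridUtility p (bertrandUtility (standardDemand D) c))
      (symmetricPureProfile n 0) := by
  refine isNashEquilibrium_symmetricPureProfile fun i b => ?_
  rcases eq_or_ne b 0 with rfl | hb
  · rw [Function.update_eq_self_iff.2 rfl]
  · have : Nontrivial (Fin n) := Fin.nontrivial_iff_two_le.2 hn
    obtain ⟨j, hj⟩ := exists_ne i
    refine le_of_eq_of_le ?_ (gridUtility_standard_nonneg hp hD hc h1 i _)
    simp only [gridUtility, bertrandUtility]
    rw [standardDemand_eq_zero (j := j), zero_mul]
    simpa [Function.update_of_ne hj] using hp (Fin.pos_iff_ne_zero.2 hb)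

theorem isNashEquilibrium_iff_of_iteratedElimination_singleton {n : ℕ} {A : Type*} [Fintype A]
    [DecidableEq A] {u : Fin n → (Fin n → A) → ℝ} {a : A} (h : IteratedElimination u {a})
    (ha : IsNashEquilibrium u (symmetricPureProfile n a)) (x : Fin n → A → ℝ) :
    IsNashEquilibrium u x ↔ x = symmetricPureProfile n a := by
  refine ⟨fun hx => ?_, fun hx => hx ▸ ha⟩
  have h0 := h.nash_support hx
  funext i b
  rcases eq_or_ne b a with rfl | hb
  · rw [symmetricPureProfile, Pi.single_eq_same, ← (hx.1 i).2]
    exact (Finset.sum_eq_single b (fun b' _ hb' => h0 i b' hb') (by simp)).symm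
  · rw [symmetricPureProfile, Pi.single_eq_of_ne hb]
    exact h0 i b hb

/-! ### Linear demand -/

section Linear

variable {n : ℕ} {α β γ c : ℝ}

/-- The average price of the competitors of firm `i`. -/
noncomputable def competitorMean (i : Fin n) (a : Fin n → ℝ) : ℝ :=
  (∑ j ∈ Finset.univ.erase i, a j) / ((n : ℝ) - 1)

theorem competitorMean_le (hn : 2 ≤ n) {i : Fin n} {a : Fin n → ℝ} {r : ℝ}
    (h : ∀ j, j ≠ i → a j ≤ r) : competitorMean i a ≤ r := by
  have hn' : (0 : ℝ) < (n : ℝ) - 1 := by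
    have : (2 : ℝ) ≤ n := by exact_mod_cast hn
    linarith
  rw [competitorMean, div_le_iff₀ hn']
  refine (Finset.sum_le_card_nsmul _ _ r fun j hj => h j (Finset.ne_of_mem_erase hj)).trans_eq ?_
  rw [Finset.card_erase_of_mem (Finset.mem_univ i), Finset.card_univ, Fintype.card_fin,
    nsmul_eq_mul, Nat.cast_pred (by omega), mul_comm]

theorem competitorMean_neg (i : Fin n) (a : Fin n → ℝ) :
    competitorMean i (fun j => -a j) = -competitorMean i a := by
  rw [competitorMean, competitorMean, Finset.sum_neg_distrib, neg_div]

theorem le_competitorMean (hn : 2 ≤ n) {i : Fin n} {a : Fin n → ℝ} {r : ℝ}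
    (h : ∀ j, j ≠ i → r ≤ a j) : r ≤ competitorMean i a := by
  have := competitorMean_le hn (a := fun j => -a j) (r := -r) fun j hj => neg_le_neg (h j hj)
  rw [competitorMean_neg] at this
  linarith

/-- A difference of two values of a quadratic with leading coefficient `-β` factors. The sign of the
second factor tells whether the midpoint of the two prices lies below or above the best response, a
convex combination of the continuous equilibrium price and the competitors' mean when `0 < γ < β`.
-/
theorem bertrandUtility_linear_sub {i : Fin n} {a b : Fin n → ℝ} (h : ∀ j, j ≠ i → a j = b j)
    (hβγ : 0 < 2 * β - γ) :
    bertrandUtility (linearDemand α β γ) c i a - bertrandUtility (linearDemand α β γ) c i b =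
      (a i - b i) * ((2 * β - γ) * continuousNashPrice α β γ c + γ * competitorMean i b -
        β * (a i + b i)) := by
  have hs : ∑ j ∈ Finset.univ.erase i, a j = ∑ j ∈ Finset.univ.erase i, b j :=
    Finset.sum_congr rfl fun j hj => h j (Finset.ne_of_mem_erase hj)
  have hp : (2 * β - γ) * continuousNashPrice α β γ c = α + β * c :=
    mul_div_cancel₀ _ hβγ.ne'
  rw [hp]
  simp only [bertrandUtility, linearDemand, competitorMean, hs]
  ring

theorem gridUtility_linear_sub {m : ℕ} (p : Fin (m + 1) → ℝ) (i : Fin n)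
    (s : Fin n → Fin (m + 1)) (b b' : Fin (m + 1)) (hβγ : 0 < 2 * β - γ) :
    gridUtility p (bertrandUtility (linearDemand α β γ) c) i (Function.update s i b) -
      gridUtility p (bertrandUtility (linearDemand α β γ) c) i (Function.update s i b') =
      (p b - p b') * ((2 * β - γ) * continuousNashPrice α β γ c +
        γ * competitorMean i (fun j => p (s j)) - β * (p b + p b')) := by
  have hm : competitorMean i (fun j => p (s j)) =
      competitorMean i (fun j => p (Function.update s i b' j)) := by
    unfold competitorMean
    rw [Finset.sum_congr rfl fun j hj => ?_]
    simp only [Function.update_of_ne (Finset.ne_of_mem_erase hj)]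
  unfold gridUtility
  rw [bertrandUtility_linear_sub (fun j hj => ?_) hβγ, hm]
  · simp
  · simp [Function.update_of_ne hj]

theorem iteratedElimination_linear (hn : 2 ≤ n) {m : ℕ} {p : Fin (m + 1) → ℝ} (hp : StrictMono p)
    (hγ : 0 < γ) (hβ : γ < β) (k : Fin m) (hk : p k.castSucc ≤ continuousNashPrice α β γ c)
    (hk' : continuousNashPrice α β γ c < p k.succ) :
    IteratedElimination (gridUtility (n := n) p (bertrandUtility (linearDemand α β γ) c))
      {k.castSucc, k.succ} := by
  have hβγ : 0 < 2 * β - γ := by linarith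
  have hset : ({k.castSucc, k.succ} : Set (Fin (m + 1))) = Set.Icc k.castSucc k.succ := by
    ext a
    simp only [Set.mem_insert_iff, Set.mem_singleton_iff, Set.mem_Icc, Fin.le_def, Fin.ext_iff,
      Fin.val_castSucc, Fin.val_succ]
    omega
  rw [hset]
  refine (IteratedElimination.Iic k.succ fun j hj i => ?_).Icc fun j hj i => ?_
  · refine .of_pure j.castSucc fun s hs => ?_
    rw [← sub_neg, gridUtility_linear_sub p i s _ _ hβγ]
    have h1 : p j.castSucc < p j.succ := hp Fin.castSucc_lt_succ
    have h2 := hp.monotone hj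
    have h3 : competitorMean i (fun j => p (s j)) ≤ p j.succ :=
      competitorMean_le hn fun l hl => hp.monotone (hs l hl)
    refine mul_neg_of_pos_of_neg (by linarith) ?_
    -- The bracket is at most `(2 * β - γ) * q - (β - γ) * p j.succ - β * p j.castSucc`, with `q`
    -- the continuous equilibrium price. Both grid prices exceed `q` and their coefficients sum to
    -- `2 * β - γ`.
    nlinarith [mul_le_mul_of_nonneg_left h3 hγ.le]
  · refine .of_pure j.succ fun s hs => ?_
    rw [← sub_pos, gridUtility_linear_sub p i s _ _ hβγ]
    have h1 : p j.castSucc < p j.succ := hp Fin.castSucc_lt_succ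
    have h2 := hp.monotone hj
    have h3 : p j.castSucc ≤ competitorMean i (fun j => p (s j)) :=
      le_competitorMean hn fun l hl => hp.monotone (hs l hl)
    refine mul_pos (by linarith) ?_
    nlinarith [mul_le_mul_of_nonneg_left h3 hγ.le]

/-- A symmetric profile is an equilibrium if its price is at least as close as any other grid
price to the best response to it. -/
theorem isNashEquilibrium_linear (hn : 2 ≤ n) {m : ℕ} {p : Fin (m + 1) → ℝ} {a : Fin (m + 1)}
    (hβγ : 0 < 2 * β - γ)
    (h : ∀ b, (p b - p a) * ((2 * β - γ) * continuousNashPrice α β γ c + γ * p a -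
      β * (p b + p a)) ≤ 0) :
    IsNashEquilibrium (gridUtility p (bertrandUtility (linearDemand α β γ) c))
      (symmetricPureProfile n a) := by
  refine isNashEquilibrium_symmetricPureProfile fun i b => ?_
  have hm : competitorMean i (fun _ => p a) = p a :=
    le_antisymm (competitorMean_le hn fun _ _ => le_rfl) (le_competitorMean hn fun _ _ => le_rfl)
  have := gridUtility_linear_sub (α := α) (c := c) p i (fun _ => a) b a hβγ
  rw [hm, Function.update_eq_self i (fun _ : Fin n => a)] at this
  exact sub_nonpos.1 (this.trans_le (h b))

/-- Only moves between the two prices around the continuous equilibrium matter. If moving up from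
the lower symmetric profile pays, then staying at the upper one pays all the more, because best
responses increase with competitors' prices. -/
theorem isNashEquilibrium_linear_or (hn : 2 ≤ n) {m : ℕ} {p : Fin (m + 1) → ℝ}
    (hp : StrictMono p)
    (hγ : 0 < γ) (hβ : γ < β) (k : Fin m) (hk : p k.castSucc ≤ continuousNashPrice α β γ c)
    (hk' : continuousNashPrice α β γ c < p k.succ) :
    IsNashEquilibrium (gridUtility p (bertrandUtility (linearDemand α β γ) c))
        (symmetricPureProfile n k.castSucc) ∨
      IsNashEquilibrium (gridUtility p (bertrandUtility (linearDemand α β γ) c))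
        (symmetricPureProfile n k.succ) := by
  have hβγ : 0 < 2 * β - γ := by linarith
  set q := continuousNashPrice α β γ c with hq
  have hlt : p k.castSucc < p k.succ := hp Fin.castSucc_lt_succ
  have hcase : ∀ b, p b ≤ p k.castSucc ∨ p k.succ ≤ p b := fun b => by
    rcases le_or_gt b k.castSucc with hb | hb
    · exact .inl (hp.monotone hb)
    · exact .inr (hp.monotone (Fin.castSucc_lt_iff_succ_le.1 hb))
  rcases le_total ((2 * β - γ) * q + γ * p k.castSucc) (β * (p k.succ + p k.castSucc)) with h | h
  · refine .inl (isNashEquilibrium_linear hn hβγ fun b => ?_)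
    rw [← hq]
    rcases hcase b with hb | hb
    · exact mul_nonpos_of_nonpos_of_nonneg (by linarith) (by nlinarith)
    · exact mul_nonpos_of_nonneg_of_nonpos (by linarith) (by nlinarith)
  · refine .inr (isNashEquilibrium_linear hn hβγ fun b => ?_)
    rw [← hq]
    rcases hcase b with hb | hb
    · exact mul_nonpos_of_nonpos_of_nonneg (by linarith) (by nlinarith)
    · exact mul_nonpos_of_nonneg_of_nonpos (by linarith) (by nlinarith)

/-- The best response to any prices is closer to the equilibrium price, by a factor less than
one, than the competitors' prices are. -/
theorem isPureNashOn_linear_iff (hn : 2 ≤ n) (hγ : 0 < γ) (hβ : γ < β)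
    (h0 : 0 ≤ continuousNashPrice α β γ c) (a : Fin n → ℝ) :
    IsPureNashOn (Set.Ici 0) (bertrandUtility (linearDemand α β γ) c) a ↔
      a = fun _ => continuousNashPrice α β γ c := by
  have hβγ : 0 < 2 * β - γ := by linarith
  set q := continuousNashPrice α β γ c with hq
  have hdiff : ∀ (a : Fin n → ℝ) i b,
      bertrandUtility (linearDemand α β γ) c i (Function.update a i b) -
        bertrandUtility (linearDemand α β γ) c i a =
        (b - a i) * ((2 * β - γ) * q + γ * competitorMean i a - β * (b + a i)) := by
    intro a i b
    rw [bertrandUtility_linear_sub (fun j hj => Function.update_of_ne hj _ _) hβγ]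
    simp [← hq]
  constructor
  · rintro ⟨ha, hN⟩
    have : Nonempty (Fin n) := ⟨⟨0, by omega⟩⟩
    -- The firm farthest from `q` is the one to move: its competitors' mean is no farther from `q`
    -- than its own price.
    obtain ⟨i, hi⟩ := Finite.exists_max fun i => |a i - q|
    have hm1 : competitorMean i a ≤ q + |a i - q| :=
      competitorMean_le hn fun j _ => by linarith [le_abs_self (a j - q), hi j]
    have hm2 : q - |a i - q| ≤ competitorMean i a :=
      le_competitorMean hn fun j _ => by linarith [neg_abs_le (a j - q), hi j]
    -- moving from `a i` to the midpoint between `a i` and the equilibrium price does not pay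
    have hdev := hN i ((a i + q) / 2) (by
      have := ha i
      simp only [Set.mem_Ici] at this ⊢
      linarith)
    rw [← sub_nonpos, hdiff] at hdev
    have hz : |a i - q| = 0 := by
      rcases le_total q (a i) with h | h
      · rw [abs_of_nonneg (sub_nonneg.2 h)] at hm1 ⊢
        by_contra hne
        have hpos : 0 < a i - q := (sub_nonneg.2 h).lt_of_ne' hne
        refine hdev.not_gt (mul_pos_of_neg_of_neg (by linarith) ?_)
        nlinarith [mul_le_mul_of_nonneg_left hm1 hγ.le]
      · rw [abs_of_nonpos (sub_nonpos.2 h)] at hm2 ⊢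
        by_contra hne
        have hpos : 0 < -(a i - q) := (neg_nonneg.2 (sub_nonpos.2 h)).lt_of_ne' hne
        refine hdev.not_gt (mul_pos (by linarith) ?_)
        nlinarith [mul_le_mul_of_nonneg_left hm2 hγ.le]
    funext j
    have := (hi j).trans_eq hz
    exact sub_eq_zero.1 (abs_nonpos_iff.1 this)
  · rintro rfl
    refine ⟨fun _ => h0, fun i b _ => ?_⟩
    have hm : competitorMean i (fun _ => q) = q :=
      le_antisymm (competitorMean_le hn fun _ _ => le_rfl) (le_competitorMean hn fun _ _ => le_rfl)
    rw [← sub_nonpos, hdiff, hm]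
    nlinarith [mul_nonneg (hγ.trans hβ).le (sq_nonneg (b - q))]

end Linear

/-! ### Law of large numbers for bounded martingale differences -/

/-- A special case of Kronecker's lemma. -/
theorem tendsto_sum_div_of_tendsto_sum_div_succ {x : ℕ → ℝ} {l : ℝ}
    (h : Tendsto (fun T => ∑ t ∈ Finset.range T, x t / ((t : ℝ) + 1)) atTop (𝓝 l)) :
    Tendsto (fun T : ℕ => (∑ t ∈ Finset.range T, x t) / (T : ℝ)) atTop (𝓝 0) := by
  set M : ℕ → ℝ := fun T => ∑ t ∈ Finset.range T, x t / ((t : ℝ) + 1) with hM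
  -- Summation by parts; after division by `T` the right side is `M T` minus a Cesàro mean with the
  -- same limit.
  have hsum : ∀ T : ℕ, ∑ t ∈ Finset.range T, x t = T * M T - ∑ t ∈ Finset.range T, M t := by
    intro T
    induction T with
    | zero => simp
    | succ T ih =>
      have hx : M (T + 1) = M T + x T / ((T : ℝ) + 1) := Finset.sum_range_succ _ _
      have hne : (T : ℝ) + 1 ≠ 0 := by positivity
      rw [Finset.sum_range_succ, ih, Finset.sum_range_succ _ T, hx]
      push_cast
      field_simp
      ring
  have h2 := h.sub h.cesaro
  rw [sub_self] at h2
  refine h2.congr' ?_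
  filter_upwards [eventually_gt_atTop 0] with T hT
  have hT' : (T : ℝ) ≠ 0 := by positivity
  rw [hsum]
  field_simp

theorem sum_range_inv_sq_le (T : ℕ) : ∑ t ∈ Finset.range T, 1 / ((t : ℝ) + 1) ^ 2 ≤ 2 := by
  have h := sum_Ioo_inv_sq_le (α := ℝ) 0 (T + 1)
  have hI : Finset.Ioo 0 (T + 1) = Finset.Ico 1 (T + 1) := by ext; simp [Nat.one_le_iff_ne_zero,
    Nat.pos_iff_ne_zero]
  rw [hI, Finset.sum_Ico_eq_sum_range] at h
  simpa [add_comm] using h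

section Learning

variable {Ω : Type*} [mΩ : MeasurableSpace Ω] {P : Measure Ω}
  {ℱ : Filtration ℕ mΩ}

/-- Partial averages of bounded martingale differences converge to zero almost surely. -/
theorem ae_tendsto_average_of_condExp_eq_zero [IsProbabilityMeasure P] {X : ℕ → Ω → ℝ} {C : ℝ}
    (hX : ∀ t, StronglyMeasurable[ℱ (t + 1)] (X t)) (hC : ∀ t, ∀ᵐ ω ∂P, |X t ω| ≤ C)
    (h0 : ∀ t, P[X t | ℱ t] =ᵐ[P] 0) :
    ∀ᵐ ω ∂P, Tendsto (fun T : ℕ => (∑ t ∈ Finset.range T, X t ω) / (T : ℝ)) atTop (𝓝 0) := by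
  -- The weights `1 / (t + 1)` are square summable, so this martingale is bounded in L² and
  -- converges; Kronecker's lemma then turns convergence into the claim.
  set M : ℕ → Ω → ℝ := fun T ω => ∑ t ∈ Finset.range T, X t ω / ((t : ℝ) + 1) with hM
  have hsucc : ∀ T, M (T + 1) = M T + fun ω => X T ω / ((T : ℝ) + 1) := fun T => by
    funext ω
    exact Finset.sum_range_succ _ _
  have hXm : ∀ t, AEStronglyMeasurable (X t) P :=
    fun t => ((hX t).mono (ℱ.le _)).aestronglyMeasurable
  have hXi : ∀ t, Integrable (X t) P := fun t => .of_bound (hXm t) C (hC t)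
  have hadp : StronglyAdapted ℱ M := fun T => by
    refine Finset.stronglyMeasurable_fun_sum _ fun t ht => ?_
    simp_rw [div_eq_mul_inv]
    exact StronglyMeasurable.mul_const ((hX t).mono (ℱ.mono (Finset.mem_range.1 ht))) _
  have hMb : ∀ T, ∀ᵐ ω ∂P, |M T ω| ≤ T * C := by
    intro T
    have : ∀ᵐ ω ∂P, ∀ t, |X t ω| ≤ C := ae_all_iff.2 hC
    filter_upwards [this] with ω hω
    refine (Finset.abs_sum_le_sum_abs _ _).trans ?_
    refine (Finset.sum_le_card_nsmul _ _ C fun t _ => ?_).trans_eq (by simp)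
    rw [abs_div, abs_of_pos (by positivity : (0 : ℝ) < (t : ℝ) + 1)]
    exact (div_le_self (abs_nonneg _) (by linarith [Nat.cast_nonneg (α := ℝ) t])).trans (hω t)
  have hMm : ∀ T, AEStronglyMeasurable (M T) P :=
    fun T => ((hadp T).mono (ℱ.le _)).aestronglyMeasurable
  have hMi : ∀ T, Integrable (M T) P := fun T => .of_bound (hMm T) (T * C) (hMb T)
  have hmart : Martingale M ℱ P := by
    refine martingale_of_condExp_sub_eq_zero_nat hadp hMi fun T => ?_
    rw [hsucc, add_sub_cancel_left]
    have h1 : (fun ω => X T ω / ((T : ℝ) + 1)) = ((T : ℝ) + 1)⁻¹ • X T := by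
      funext ω
      simp [div_eq_inv_mul]
    rw [h1]
    refine (condExp_smul _ _ _).trans ?_
    filter_upwards [h0 T] with ω hω
    simp [hω]
  have hM2 : ∀ T, Integrable (fun ω => M T ω ^ 2) P := fun T => by
    refine .of_bound ((hMm T).pow 2) ((T * C) ^ 2) ?_
    filter_upwards [hMb T] with ω hω
    rw [Real.norm_eq_abs, abs_pow]
    exact pow_le_pow_left₀ (abs_nonneg _) hω 2
  have hsq : ∀ T, ∫ ω, M T ω ^ 2 ∂P ≤ C ^ 2 * ∑ t ∈ Finset.range T, 1 / ((t : ℝ) + 1) ^ 2 := by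
    intro T
    induction T with
    | zero => simp [hM]
    | succ T ih =>
      -- Martingale increments are orthogonal to the past, so second moments add up.
      have hcross : ∫ ω, (M T * X T) ω ∂P = 0 := by
        rw [← integral_condExp (ℱ.le T)]
        refine integral_eq_zero_of_ae ?_
        refine (condExp_stronglyMeasurable_mul_of_bound (ℱ.le T) (hadp T) (hXi T) (T * C)
          (hMb T)).trans ?_
        filter_upwards [h0 T] with ω hω
        simp [hω]
      have hMX : Integrable (M T * X T) P := (hXi T).bdd_mul (hMm T) (hMb T)
      have hX2 : Integrable (fun ω => X T ω ^ 2) P := by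
        refine .of_bound ((hXm T).pow 2) (C ^ 2) ?_
        filter_upwards [hC T] with ω hω
        rw [Real.norm_eq_abs, abs_pow]
        exact pow_le_pow_left₀ (abs_nonneg _) hω 2
      have hX2le : ∫ ω, X T ω ^ 2 ∂P ≤ C ^ 2 := by
        refine (integral_mono_ae hX2 (integrable_const (C ^ 2)) ?_).trans_eq (by simp)
        filter_upwards [hC T] with ω hω
        rw [← sq_abs]
        exact pow_le_pow_left₀ (abs_nonneg _) hω 2
      have hexp : ∀ ω, M (T + 1) ω ^ 2 = M T ω ^ 2 + (2 / ((T : ℝ) + 1) * (M T * X T) ω +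
          1 / ((T : ℝ) + 1) ^ 2 * X T ω ^ 2) := by
        intro ω
        have hne : (T : ℝ) + 1 ≠ 0 := by positivity
        rw [hsucc]
        simp only [Pi.add_apply, Pi.mul_apply]
        field_simp
        ring
      have hI : Integrable (fun ω => 2 / ((T : ℝ) + 1) * (M T * X T) ω +
          1 / ((T : ℝ) + 1) ^ 2 * X T ω ^ 2) P := (hMX.const_mul _).add (hX2.const_mul _)
      simp_rw [hexp]
      rw [integral_add (hM2 T) hI, integral_add (hMX.const_mul _) (hX2.const_mul _),
        integral_const_mul, integral_const_mul,
        hcross, mul_zero, zero_add, Finset.sum_range_succ, mul_add]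
      refine add_le_add ih ?_
      rw [mul_comm (C ^ 2)]
      exact mul_le_mul_of_nonneg_left hX2le (by positivity)
  have hL1 : ∀ T, eLpNorm (M T) 1 P ≤ (Real.toNNReal (1 + C ^ 2 * 2) : ENNReal) := by
    intro T
    rw [eLpNorm_one_eq_lintegral_enorm, ← ofReal_integral_norm_eq_lintegral_enorm (hMi T)]
    refine ENNReal.ofReal_le_ofReal ?_
    calc ∫ ω, ‖M T ω‖ ∂P ≤ ∫ ω, (1 + M T ω ^ 2) ∂P := by
          refine integral_mono (hMi T).norm ((integrable_const _).add (hM2 T)) fun ω => ?_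
          simp only [Real.norm_eq_abs]
          nlinarith [sq_abs (M T ω), sq_nonneg (|M T ω| - 1), abs_nonneg (M T ω)]
      _ = 1 + ∫ ω, M T ω ^ 2 ∂P := by
          rw [integral_add (integrable_const _) (hM2 T)]; simp
      _ ≤ 1 + C ^ 2 * 2 := by
          have := mul_le_mul_of_nonneg_left (sum_range_inv_sq_le T) (sq_nonneg C)
          linarith [hsq T]
  filter_upwards [hmart.submartingale.exists_ae_tendsto_of_bdd hL1] with ω ⟨l, hl⟩
  exact tendsto_sum_div_of_tendsto_sum_div_succ hl

/-! ### Repeated play: almost sure behaviour of averages -/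

theorem ae_mixedStrategy_nonneg {n : ℕ} {A : Type*} [Finite A] {act : ℕ → Ω → Fin n → A} :
    ∀ᵐ ω ∂P, ∀ t i a, 0 ≤ mixedStrategy P ℱ act t i a ω := by
  refine ae_all_iff.2 fun t => ae_all_iff.2 fun i => ae_all_iff.2 fun a => ?_
  exact condExp_nonneg (Eventually.of_forall fun ω => Set.indicator_nonneg (by simp) ω)

section RepeatedPlay

variable {n : ℕ} {A : Type*} [MeasurableSpace A]
  {u : Fin n → (Fin n → A) → ℝ} {U : ℕ → Fin n → (Fin n → A) → Ω → ℝ}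
  {d : Fin n → ℕ} {pre : Fin n → ℕ → A → Ω → ℝ} {act : ℕ → Ω → Fin n → A}

theorem IsRepeatedPlay.measurableSet_act_eq [MeasurableSingletonClass A]
    (h : IsRepeatedPlay P ℱ u U d pre act)
    (t : ℕ) (i : Fin n) (a : A) : MeasurableSet[ℱ (t + 1)] {ω | act t ω i = a} :=
  (measurable_pi_apply i).comp (h.measurable_act t) (measurableSet_singleton a)

/-- An indicator minus its conditional probability is a bounded martingale difference. -/
theorem IsRepeatedPlay.ae_tendsto_average_indicator_sub [IsProbabilityMeasure P] [Finite A]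
    [MeasurableSingletonClass A]
    (h : IsRepeatedPlay P ℱ u U d pre act) :
    ∀ᵐ ω ∂P, ∀ i a, Tendsto (fun T : ℕ => (∑ t ∈ Finset.range T,
      (Set.indicator {ω | act t ω i = a} (fun _ => (1 : ℝ)) ω - mixedStrategy P ℱ act t i a ω)) /
        (T : ℝ)) atTop (𝓝 0) := by
  refine ae_all_iff.2 fun i => ae_all_iff.2 fun a => ?_
  have hm := fun t => h.measurableSet_act_eq t i a
  have hint : ∀ t, Integrable (Set.indicator {ω | act t ω i = a} fun _ => (1 : ℝ)) P :=
    fun t => (integrable_const 1).indicator (ℱ.le _ _ (hm t))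
  refine ae_tendsto_average_of_condExp_eq_zero (ℱ := ℱ) (C := 2) (fun t => ?_) (fun t => ?_)
    fun t => ?_
  · exact (stronglyMeasurable_const.indicator (hm t)).sub
      (stronglyMeasurable_condExp.mono (ℱ.mono t.le_succ))
  · have hb : ∀ ω, |Set.indicator {ω | act t ω i = a} (fun _ => (1 : ℝ)) ω| ≤ (1 : ℝ) := by
      intro ω
      by_cases hω : act t ω i = a <;> simp [hω]
    filter_upwards [ae_bdd_abs_condExp_of_ae_bdd_abs (m := ℱ t) (Eventually.of_forall hb)] with ω hω
    have := hb ω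
    refine (abs_sub _ _).trans ?_
    simp only [mixedStrategy]
    linarith
  · refine (condExp_sub (hint t) integrable_condExp _).trans ?_
    rw [condExp_of_stronglyMeasurable (ℱ.le t) stronglyMeasurable_condExp integrable_condExp]
    exact Eventually.of_forall fun ω => by simp

/-- Condition first on the larger σ-algebra `m₁ ⊔ m₂`: there the indicator factors out and the
centred `V`, being independent, has conditional mean zero. The tower property does the rest. -/
theorem condExp_indicator_mul_eq_zero_of_indep [IsProbabilityMeasure P]
    {m₁ m₂ : MeasurableSpace Ω} (hm₁ : m₁ ≤ mΩ)
    (hm₂ : m₂ ≤ mΩ) {V : Ω → ℝ} (hV : Measurable[mΩ] V) (hVi : Integrable V P) {B : Set Ω}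
    (hB : MeasurableSet[m₂] B) (hind : Indep (MeasurableSpace.comap V inferInstance) (m₁ ⊔ m₂) P) :
    P[fun ω => Set.indicator B (fun _ => (1 : ℝ)) ω * (V ω - ∫ ω, V ω ∂P) | m₁] =ᵐ[P] 0 := by
  have hG : m₁ ⊔ m₂ ≤ mΩ := sup_le hm₁ hm₂
  have hW : Integrable (fun ω => V ω - ∫ ω, V ω ∂P) P := hVi.sub (integrable_const _)
  have hBm : StronglyMeasurable[m₁ ⊔ m₂] (Set.indicator B fun _ => (1 : ℝ)) :=
    stronglyMeasurable_const.indicator ((le_sup_right : m₂ ≤ m₁ ⊔ m₂) B hB)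
  have h1 : P[fun ω => Set.indicator B (fun _ => (1 : ℝ)) ω * (V ω - ∫ ω, V ω ∂P) | m₁ ⊔ m₂]
      =ᵐ[P] 0 := by
    refine (condExp_stronglyMeasurable_mul_of_bound hG hBm hW 1 ?_).trans ?_
    · refine Eventually.of_forall fun ω => ?_
      by_cases hω : ω ∈ B <;> simp [hω]
    · have hVm : StronglyMeasurable[MeasurableSpace.comap V inferInstance]
          (fun ω => V ω - ∫ ω, V ω ∂P) :=
        ((comap_measurable V).sub_const _).stronglyMeasurable
      filter_upwards [condExp_indep_eq hV.comap_le hG hVm hind] with ω hω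
      simp [hω, integral_sub hVi (integrable_const _)]
  refine (condExp_condExp_of_le (le_sup_left : m₁ ≤ m₁ ⊔ m₂) hG).symm.trans ?_
  refine (condExp_congr_ae h1).trans ?_
  rw [condExp_zero]

theorem IsRepeatedPlay.ae_tendsto_average_payoff_sub [IsProbabilityMeasure P] [Finite A]
    [MeasurableSingletonClass A]
    (h : IsRepeatedPlay P ℱ u U d pre act) :
    ∀ᵐ ω ∂P, ∀ i a, Tendsto (fun T : ℕ => (∑ t ∈ Finset.range T,
      (U t i (Function.update (act t ω) i a) ω - u i (Function.update (act t ω) i a))) /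
        (T : ℝ)) atTop (𝓝 0) := by
  classical
  have := Fintype.ofFinite A
  obtain ⟨lo, hi, hU⟩ := h.bounded_payoff
  have hUm : ∀ t i s, Measurable (U t i s) := fun t i s => (h.measurable_payoff t i s).mono
    (ℱ.le _) le_rfl
  have hUb : ∀ t i s ω, |U t i s ω| ≤ max |lo| |hi| :=
    fun t i s ω => abs_le_max_abs_abs (hU t i s ω).1 (hU t i s ω).2
  have hUi : ∀ t i s, Integrable (U t i s) P := fun t i s =>
    .of_bound (hUm t i s).aestronglyMeasurable _ (Eventually.of_forall (hUb t i s))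
  have hub : ∀ i s, |u i s| ≤ max |lo| |hi| := fun i s => by
    rw [← h.mean_payoff 0 i s]
    simpa using norm_integral_le_of_norm_le_const (μ := P) (f := U 0 i s)
      (Eventually.of_forall fun ω => hUb 0 i s ω)
  refine ae_all_iff.2 fun i => ae_all_iff.2 fun a => ?_
  -- Independence and means are given for fixed profiles only, so the payoff at the random profile
  -- is split according to its finitely many values.
  have hsum : ∀ t, (fun ω => U t i (Function.update (act t ω) i a) ω -
      u i (Function.update (act t ω) i a)) = fun ω => ∑ s,
        Set.indicator (act t ⁻¹' {s' | Function.update s' i a = s}) (fun _ => (1 : ℝ)) ω *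
          (U t i s ω - u i s) := fun t => by
    funext ω
    rw [Finset.sum_eq_single (Function.update (act t ω) i a)]
    · simp
    · intro s _ hs
      simp [hs.symm]
    · simp
  have hB : ∀ t s, MeasurableSet[MeasurableSpace.comap (act t) inferInstance]
      (act t ⁻¹' {s' | Function.update s' i a = s}) :=
    fun t s => ⟨_, (Set.toFinite _).measurableSet, rfl⟩
  refine ae_tendsto_average_of_condExp_eq_zero (ℱ := ℱ) (C := max |lo| |hi| + max |lo| |hi|)
    (fun t => ?_) (fun t => ?_) fun t => ?_
  · rw [hsum]
    refine Finset.stronglyMeasurable_fun_sum _ fun s _ => ?_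
    refine StronglyMeasurable.mul (stronglyMeasurable_const.indicator ?_)
      ((h.measurable_payoff t i s).sub_const _).stronglyMeasurable
    exact (h.measurable_act t).comap_le _ (hB t s)
  · exact Eventually.of_forall fun ω => (abs_sub _ _).trans (add_le_add (hUb _ _ _ _) (hub _ _))
  · rw [hsum]
    have hact : MeasurableSpace.comap (act t) inferInstance ≤ mΩ :=
      (h.measurable_act t).comap_le.trans (ℱ.le _)
    have hfs : (fun ω => ∑ s,
        Set.indicator (act t ⁻¹' {s' | Function.update s' i a = s}) (fun _ => (1 : ℝ)) ω *
          (U t i s ω - u i s)) = ∑ s, fun ω =>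
        Set.indicator (act t ⁻¹' {s' | Function.update s' i a = s}) (fun _ => (1 : ℝ)) ω *
          (U t i s ω - u i s) := by
      funext ω
      simp
    rw [hfs]
    refine (condExp_finsetSum (fun s _ => ?_) _).trans ?_
    · refine ((hUi t i s).sub (integrable_const _)).bdd_mul (c := 1)
        (stronglyMeasurable_const.indicator (hact _ (hB t s))).aestronglyMeasurable
        (Eventually.of_forall fun ω => ?_)
      by_cases hω : Function.update (act t ω) i a = s <;> simp [hω]
    · have hz : ∀ᵐ ω ∂P, ∀ s, (P[fun ω =>
          Set.indicator (act t ⁻¹' {s' | Function.update s' i a = s}) (fun _ => (1 : ℝ)) ω *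
            (U t i s ω - u i s) | ℱ t]) ω = 0 := by
        refine ae_all_iff.2 fun s => ?_
        have := condExp_indicator_mul_eq_zero_of_indep (ℱ.le t) hact (hUm t i s) (hUi t i s)
          (hB t s) (h.indep_payoff t i s)
        rwa [h.mean_payoff t i s] at this
      filter_upwards [hz] with ω hω
      rw [Finset.sum_apply]
      exact Finset.sum_eq_zero fun s _ => hω s

/-- A fixed initial reward `c` and `e` extra rounds do not affect long-run averages; boundedness of
`y` controls the change of denominator. -/
theorem tendsto_add_sum_div_sub {x y : ℕ → ℝ} {K : ℝ} (hy : ∀ t, |y t| ≤ K)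
    (hxy : Tendsto (fun T : ℕ => (∑ t ∈ Finset.range T, (x t - y t)) / (T : ℝ)) atTop (𝓝 0))
    (c : ℝ) (e : ℕ) :
    Tendsto (fun T : ℕ => (c + ∑ t ∈ Finset.range T, x t) / ((e : ℝ) + T) -
      (∑ t ∈ Finset.range T, y t) / T) atTop (𝓝 0) := by
  have hq : Tendsto (fun T : ℕ => (T : ℝ) / (T + (e : ℝ))) atTop (𝓝 1) :=
    tendsto_natCast_div_add_atTop (e : ℝ)
  have h1 := ((tendsto_const_div_atTop_nhds_zero_nat c).add hxy).mul hq
  have h2 : Tendsto (fun T : ℕ => (∑ t ∈ Finset.range T, y t) / T * ((T : ℝ) / (T + (e : ℝ)) - 1))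
      atTop (𝓝 0) := by
    have h3 : Tendsto (fun T : ℕ => K * |(T : ℝ) / (T + (e : ℝ)) - 1|) atTop (𝓝 0) := by
      simpa using ((hq.sub_const 1).abs).const_mul K
    refine squeeze_zero_norm (fun T => ?_) h3
    rw [Real.norm_eq_abs, abs_mul]
    refine mul_le_mul_of_nonneg_right ?_ (abs_nonneg _)
    have hK : 0 ≤ K := (abs_nonneg _).trans (hy 0)
    rw [abs_div, Nat.abs_cast]
    refine div_le_of_le_mul₀ (Nat.cast_nonneg _) hK ?_
    refine (Finset.abs_sum_le_sum_abs _ _).trans ?_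
    refine (Finset.sum_le_card_nsmul _ _ K fun t _ => hy t).trans_eq ?_
    rw [Finset.card_range, nsmul_eq_mul, mul_comm]
  have h4 := h1.add h2
  simp only [add_zero, zero_mul] at h4
  refine h4.congr' ?_
  filter_upwards [eventually_gt_atTop 0] with T hT
  have hT' : (T : ℝ) ≠ 0 := by positivity
  have hT2 : (T : ℝ) + e ≠ 0 := by positivity
  have hT3 : (e : ℝ) + T ≠ 0 := by positivity
  rw [Finset.sum_sub_distrib]
  field_simp
  ring

/-- Average rewards are asymptotically the averages of the mean payoffs against the actions
played by the opponents. -/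
theorem IsRepeatedPlay.ae_tendsto_averageReward_sub [IsProbabilityMeasure P] [Finite A]
    [MeasurableSingletonClass A]
    (h : IsRepeatedPlay P ℱ u U d pre act) :
    ∀ᵐ ω ∂P, ∀ i a, Tendsto (fun T : ℕ => averageReward U d pre act i T a ω -
      (∑ t ∈ Finset.range T, u i (Function.update (act t ω) i a)) / T) atTop (𝓝 0) := by
  filter_upwards [h.ae_tendsto_average_payoff_sub] with ω hω i a
  obtain ⟨K, hK⟩ := (Set.finite_range fun s => |u i s|).bddAbove
  exact tendsto_add_sum_div_sub (fun t => hK ⟨_, rfl⟩) (hω i a) _ (d i)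

theorem IsRepeatedPlay.ae_sum_mixedStrategy_eq_one [IsProbabilityMeasure P] [Fintype A]
    [MeasurableSingletonClass A]
    (h : IsRepeatedPlay P ℱ u U d pre act) :
    ∀ᵐ ω ∂P, ∀ t i, ∑ a, mixedStrategy P ℱ act t i a ω = 1 := by
  classical
  refine ae_all_iff.2 fun t => ae_all_iff.2 fun i => ?_
  have h1 : ∑ a, Set.indicator {ω | act t ω i = a} (fun _ => (1 : ℝ)) = fun _ => 1 := by
    funext ω
    simp [Set.indicator_apply]
  have h2 := condExp_finsetSum (μ := P) (s := Finset.univ)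
    (f := fun a => Set.indicator {ω | act t ω i = a} (fun _ => (1 : ℝ)))
    (fun a _ => (integrable_const 1).indicator (ℱ.le _ _ (h.measurableSet_act_eq t i a))) (ℱ t)
  rw [h1, condExp_const (ℱ.le t)] at h2
  filter_upwards [h2] with ω hω
  simpa [mixedStrategy] using hω.symm

end RepeatedPlay

/-! ### Frequencies along a sequence of action profiles -/

section Frequencies

variable {n : ℕ} {A : Type*} {s : ℕ → Fin n → A} {S : Set A}

/-- Union bound over the finitely many players and actions outside `S`. -/
theorem timeAverageConverges_of_frequency_tendsto_zero [Finite A]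
    (h : ∀ i, ∀ a ∉ S, Tendsto (fun T : ℕ => (∑ t ∈ Finset.range T,
      Set.indicator {b : Fin n → A | b i = a} (fun _ => (1 : ℝ)) (s t)) / (T : ℝ))
        atTop (𝓝 0)) : TimeAverageConverges s S := by
  classical
  have := Fintype.ofFinite A
  set F : Finset A := Finset.univ.filter (· ∉ S)
  have hlim : Tendsto (fun T : ℕ => 1 - ∑ i, ∑ a ∈ F, (∑ t ∈ Finset.range T,
      Set.indicator {b : Fin n → A | b i = a} (fun _ => (1 : ℝ)) (s t)) / (T : ℝ))
      atTop (𝓝 1) := by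
    have := tendsto_finsetSum Finset.univ fun i _ => tendsto_finsetSum F fun a ha =>
      h i a (Finset.mem_filter.1 ha).2
    simpa using this.const_sub 1
  have hpt : ∀ b : Fin n → A, 1 - ∑ i, ∑ a ∈ F,
      Set.indicator {b : Fin n → A | b i = a} (fun _ => (1 : ℝ)) b ≤
        Set.indicator {b : Fin n → A | ∀ i, b i ∈ S} (fun _ => (1 : ℝ)) b := by
    intro b
    have hnn : ∀ i a, 0 ≤ Set.indicator {b : Fin n → A | b i = a} (fun _ => (1 : ℝ)) b :=
      fun i a => Set.indicator_nonneg (by simp) b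
    by_cases hb : ∀ i, b i ∈ S
    · rw [Set.indicator_of_mem (by exact hb)]
      linarith [Finset.sum_nonneg fun i (_ : i ∈ Finset.univ) =>
        Finset.sum_nonneg fun a (_ : a ∈ F) => hnn i a]
    · rw [Set.indicator_of_notMem (by exact hb)]
      push Not at hb
      obtain ⟨i, hi⟩ := hb
      have h1 : 1 ≤ ∑ a ∈ F, Set.indicator {b : Fin n → A | b i = a} (fun _ => (1 : ℝ)) b := by
        refine le_trans ?_ (Finset.single_le_sum (fun a _ => hnn i a)
          (Finset.mem_filter.2 ⟨Finset.mem_univ _, hi⟩))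
        simp
      have h2 := Finset.single_le_sum (f := fun i => ∑ a ∈ F,
        Set.indicator {b : Fin n → A | b i = a} (fun _ => (1 : ℝ)) b)
        (fun i _ => Finset.sum_nonneg fun a (_ : a ∈ F) => hnn i a) (Finset.mem_univ i)
      linarith
  refine tendsto_of_tendsto_of_tendsto_of_le_of_le' hlim tendsto_const_nhds ?_ ?_
  · filter_upwards [eventually_gt_atTop 0] with T hT
    have hT' : (0 : ℝ) < T := by positivity
    rw [le_div_iff₀ hT']
    have hsum := Finset.sum_le_sum fun t (_ : t ∈ Finset.range T) => hpt (s t)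
    refine le_of_eq_of_le ?_ hsum
    have hcomm : ∑ t ∈ Finset.range T, ∑ i, ∑ a ∈ F,
        Set.indicator {b : Fin n → A | b i = a} (fun _ => (1 : ℝ)) (s t) =
        ∑ i, ∑ a ∈ F, ∑ t ∈ Finset.range T,
          Set.indicator {b : Fin n → A | b i = a} (fun _ => (1 : ℝ)) (s t) := by
      rw [Finset.sum_comm]
      exact Finset.sum_congr rfl fun i _ => Finset.sum_comm
    simp_rw [← Finset.sum_div]
    rw [Finset.sum_sub_distrib, sub_mul, div_mul_cancel₀ _ hT'.ne', hcomm]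
    simp
  · refine Eventually.of_forall fun T => div_le_one_of_le₀ ?_ (Nat.cast_nonneg _)
    refine (Finset.sum_le_card_nsmul _ _ 1 fun t _ => ?_).trans_eq (by simp)
    exact Set.indicator_le_self' (by simp) _

/-- If the opponents' actions lie in `S` most of the time, then in the long run a strictly
dominated action earns less on average than the dominating mixture. -/
theorem eventually_le_average_sub_average [Fintype A] {u : Fin n → (Fin n → A) → ℝ} {i : Fin n}
    {b : A} {w : A → ℝ} (hs : TimeAverageConverges s S)
    (hw : ∀ s : Fin n → A, (∀ j, j ≠ i → s j ∈ S) →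
      u i (Function.update s i b) < ∑ a, w a * u i (Function.update s i a)) :
    ∃ ε > 0, ∀ᶠ T : ℕ in atTop,
      ε ≤ ∑ a, w a * ((∑ t ∈ Finset.range T, u i (Function.update (s t) i a)) / (T : ℝ)) -
        (∑ t ∈ Finset.range T, u i (Function.update (s t) i b)) / (T : ℝ) := by
  classical
  set G : (Fin n → A) → ℝ := fun s' =>
    ∑ a, w a * u i (Function.update s' i a) - u i (Function.update s' i b) with hG
  obtain ⟨ε, hε, hGε⟩ : ∃ ε > 0, ∀ s' : Fin n → A, (∀ j, s' j ∈ S) → ε ≤ G s' := by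
    have : Nonempty (Fin n → A) := ⟨s 0⟩
    -- Finiteness makes the domination gap uniform. The value `1` for profiles leaving `S` keeps the
    -- minimum positive and is otherwise irrelevant.
    obtain ⟨s₀, hs₀⟩ := Finite.exists_min fun s' : Fin n → A =>
      if ∀ j, s' j ∈ S then G s' else 1
    refine ⟨_, ?_, fun s' hs' => (hs₀ s').trans_eq (if_pos hs')⟩
    split_ifs with h
    · exact sub_pos.2 (hw s₀ fun j _ => h j)
    · exact one_pos
  -- Profiles outside `S` may have a negative gap, but only down to `K`, and their frequency
  -- vanishes; half of the uniform gap remains.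
  obtain ⟨K, hK⟩ := (Set.finite_range G).bddBelow
  have hpt : ∀ s', K + (ε - K) * Set.indicator {b : Fin n → A | ∀ i, b i ∈ S}
      (fun _ => (1 : ℝ)) s' ≤ G s' := by
    intro s'
    by_cases h : ∀ j, s' j ∈ S
    · rw [Set.indicator_of_mem (by exact h)]
      linarith [hGε s' h]
    · rw [Set.indicator_of_notMem (by exact h)]
      simpa using hK ⟨s', rfl⟩
  have hlim := (Tendsto.const_mul (ε - K) hs).const_add K
  have hev := hlim.eventually (lt_mem_nhds (show ε / 2 < K + (ε - K) * 1 by linarith))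
  refine ⟨ε / 2, half_pos hε, ?_⟩
  filter_upwards [hev, eventually_gt_atTop 0] with T hT hT0
  have hT' : (0 : ℝ) < T := by positivity
  have hsum := Finset.sum_le_sum fun t (_ : t ∈ Finset.range T) => hpt (s t)
  rw [Finset.sum_add_distrib, ← Finset.mul_sum] at hsum
  have hGsum : ∑ a, w a * ((∑ t ∈ Finset.range T, u i (Function.update (s t) i a)) / (T : ℝ)) -
      (∑ t ∈ Finset.range T, u i (Function.update (s t) i b)) / (T : ℝ) =
      (∑ t ∈ Finset.range T, G (s t)) / T := by
    simp only [hG, Finset.sum_sub_distrib]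
    rw [sub_div, Finset.sum_comm]
    simp_rw [Finset.sum_div, Finset.mul_sum, mul_div_assoc]
  rw [hGsum]
  refine hT.le.trans ?_
  rw [le_div_iff₀ hT']
  refine le_of_eq_of_le ?_ hsum
  simp only [Finset.sum_const, Finset.card_range, nsmul_eq_mul]
  field_simp

end Frequencies

/-! ### Mean-based learning -/

section MeanBased

variable {n : ℕ} {A : Type*} [MeasurableSpace A] [MeasurableSingletonClass A]
  {u : Fin n → (Fin n → A) → ℝ} {U : ℕ → Fin n → (Fin n → A) → Ω → ℝ}
  {d : Fin n → ℕ} {pre : Fin n → ℕ → A → Ω → ℝ} {act : ℕ → Ω → Fin n → A} {S : Set A}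

/-- Probabilities tending to zero have Cesàro means tending to zero, and empirical frequencies
follow these means. -/
theorem IsRepeatedPlay.ae_timeAverageConverges [IsProbabilityMeasure P] [Finite A]
    (h : IsRepeatedPlay P ℱ u U d pre act)
    (hS : ∀ᵐ ω ∂P, ∀ i, ∀ a ∉ S,
      Tendsto (fun t => mixedStrategy P ℱ act t i a ω) atTop (𝓝 0)) :
    ∀ᵐ ω ∂P, TimeAverageConverges (fun t => act t ω) S := by
  filter_upwards [hS, h.ae_tendsto_average_indicator_sub] with ω h0 hlim
  refine timeAverageConverges_of_frequency_tendsto_zero fun i a ha => ?_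
  have := (hlim i a).add (h0 i a ha).cesaro
  rw [add_zero] at this
  refine this.congr fun T => ?_
  rw [Finset.sum_sub_distrib, ← div_eq_inv_mul, ← add_div, sub_add_cancel]
  rfl

/-- Mean-based players eventually stop playing the actions that are removed by iterated
elimination of strictly dominated actions. -/
theorem IteratedElimination.ae_tendsto_mixedStrategy [IsProbabilityMeasure P] [Fintype A]
    (hS : IteratedElimination u S) (h : IsRepeatedPlay P ℱ u U d pre act)
    (hmb : ∀ i, IsMeanBased P ℱ U d pre act i) :
    ∀ᵐ ω ∂P, ∀ i, ∀ a ∉ S,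
      Tendsto (fun t => mixedStrategy P ℱ act t i a ω) atTop (𝓝 0) := by
  induction hS with
  | univ => exact Eventually.of_forall fun ω i a ha => absurd (Set.mem_univ a) ha
  | @step S b _ hb ih =>
    choose w hw hdom using hb
    choose g _ hg hgx using hmb
    have hgx' : ∀ᵐ ω ∂P, ∀ i t a a',
        g i (d i + t) < averageReward U d pre act i t a' ω - averageReward U d pre act i t a ω →
          mixedStrategy P ℱ act t i a ω ≤ g i (d i + t) :=
      ae_all_iff.2 fun i => ae_all_iff.2 fun t => ae_all_iff.2 fun a => ae_all_iff.2 fun a' =>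
        hgx i t a a'
    filter_upwards [ih, h.ae_timeAverageConverges ih, h.ae_tendsto_averageReward_sub, hgx',
      ae_mixedStrategy_nonneg (P := P) (ℱ := ℱ) (act := act)] with ω hω hfreq havg hmean hnn i a ha
    by_cases haS : a ∉ S
    · exact hω i a haS
    obtain rfl : a = b := by simpa [not_not.1 haS] using ha
    obtain ⟨ε, hε, hev⟩ := eventually_le_average_sub_average hfreq (hdom i)
    have hgi : Tendsto (fun t => g i (d i + t)) atTop (𝓝 0) := by
      simpa only [add_comm] using (tendsto_add_atTop_iff_nat (d i)).2 (hg i)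
    have hdiff := (tendsto_finsetSum Finset.univ fun a' _ =>
      (havg i a').const_mul (w i a')).sub (havg i a)
    simp only [mul_zero, Finset.sum_const_zero, sub_zero] at hdiff
    refine tendsto_of_tendsto_of_tendsto_of_le_of_le' tendsto_const_nhds hgi
      (Eventually.of_forall fun t => hnn t i a) ?_
    filter_upwards [hev, hdiff.eventually (lt_mem_nhds (neg_lt_zero.2 (half_pos hε))),
      hgi.eventually (gt_mem_nhds (half_pos hε))] with T h1 h2 h3
    -- Of the margin `ε`, replacing mean payoffs by average rewards costs less than `ε / 2`, and the
    -- threshold is below the other half.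
    have h4 : g i (d i + T) < ∑ a', w i a' *
        (averageReward U d pre act i T a' ω - averageReward U d pre act i T a ω) := by
      simp only [mul_sub, Finset.sum_sub_distrib] at h2 ⊢
      rw [← Finset.sum_mul, (hw i).2]
      linarith
    -- The mean-based condition compares pure actions, so a pure action doing at least as well as
    -- the mixture is extracted.
    obtain ⟨a', ha'⟩ : ∃ a', g i (d i + T) <
        averageReward U d pre act i T a' ω - averageReward U d pre act i T a ω := by
      by_contra! hcon
      refine h4.not_ge ?_
      calc _ ≤ ∑ a', w i a' * g i (d i + T) := Finset.sum_le_sum fun a' _ =>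
            mul_le_mul_of_nonneg_left (hcon a') ((hw i).1 a')
        _ = g i (d i + T) := by rw [← Finset.sum_mul, (hw i).2, one_mul]
    exact hmean i T a a' ha'

theorem IteratedElimination.ae_tendsto_symmetricPureProfile [IsProbabilityMeasure P] [Fintype A]
    [DecidableEq A] {a : A}
    (hS : IteratedElimination u {a}) (h : IsRepeatedPlay P ℱ u U d pre act)
    (hmb : ∀ i, IsMeanBased P ℱ U d pre act i) :
    ∀ᵐ ω ∂P, ∀ i b, Tendsto (fun t => mixedStrategy P ℱ act t i b ω) atTop
      (𝓝 (symmetricPureProfile n a i b)) := by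
  filter_upwards [hS.ae_tendsto_mixedStrategy h hmb, h.ae_sum_mixedStrategy_eq_one]
    with ω h0 h1 i b
  rcases eq_or_ne b a with rfl | hb
  · have hsum := tendsto_finsetSum (Finset.univ.erase b) fun c hc =>
      h0 i c (Finset.ne_of_mem_erase hc)
    have := hsum.const_sub 1
    simp only [Finset.sum_const_zero, sub_zero] at this
    rw [symmetricPureProfile, Pi.single_eq_same]
    refine this.congr fun t => ?_
    rw [← h1 t i, ← Finset.add_sum_erase _ _ (Finset.mem_univ b), add_sub_cancel_right]
  · rw [symmetricPureProfile, Pi.single_eq_of_ne hb]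
    exact h0 i b hb

end MeanBased

end Learning

/-! ### The theorem for both demand models -/

theorem mainTheorem2 {Ω : Type*} [mΩ : MeasurableSpace Ω] (P : Measure Ω)
    [IsProbabilityMeasure P] (ℱ : Filtration ℕ mΩ) (n : ℕ) (hn : 2 ≤ n)
    (m : ℕ) (p : Fin (m + 1) → ℝ) (hp : StrictMono p) (c : ℝ)
    (U : ℕ → Fin n → (Fin n → Fin (m + 1)) → Ω → ℝ)
    (d : Fin n → ℕ) (pre : Fin n → ℕ → Fin (m + 1) → Ω → ℝ)
    (act : ℕ → Ω → Fin n → Fin (m + 1)) :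
    -- standard demand
    (∀ D : ℝ, 0 < D → c < p 0 → p (Fin.last m) ≤ 1 →
      (∀ k : Fin m, c ≤ p k.castSucc - (p k.succ - p k.castSucc)) →
      (∀ x : Fin n → Fin (m + 1) → ℝ,
        IsNashEquilibrium (gridUtility p (bertrandUtility (standardDemand D) c)) x ↔
          x = symmetricPureProfile n 0) ∧
      (IsRepeatedPlay P ℱ (gridUtility p (bertrandUtility (standardDemand D) c)) U d pre act →
        (∀ i, IsMeanBased P ℱ U d pre act i) →
        ∀ᵐ ω ∂P,
          TimeAverageConverges (fun t => act t ω) {0} ∧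
          ∀ i a, Tendsto (fun t => mixedStrategy P ℱ act t i a ω) atTop
            (𝓝 (symmetricPureProfile n 0 i a)))) ∧
    -- linear demand
    (∀ α β γ : ℝ, 0 < γ → γ < β → 0 ≤ p 0 →
      ∀ k : Fin m, p k.castSucc ≤ continuousNashPrice α β γ c →
        continuousNashPrice α β γ c < p k.succ →
      (∀ a : Fin n → ℝ,
        IsPureNashOn (Set.Ici 0) (bertrandUtility (linearDemand α β γ) c) a ↔
          a = fun _ => continuousNashPrice α β γ c) ∧
      (IsNashEquilibrium (gridUtility p (bertrandUtility (linearDemand α β γ) c))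
          (symmetricPureProfile n k.castSucc) ∨
        IsNashEquilibrium (gridUtility p (bertrandUtility (linearDemand α β γ) c))
          (symmetricPureProfile n k.succ)) ∧
      (∀ x : Fin n → Fin (m + 1) → ℝ,
        IsNashEquilibrium (gridUtility p (bertrandUtility (linearDemand α β γ) c)) x →
          ∀ i a, x i a ≠ 0 → a = k.castSucc ∨ a = k.succ) ∧
      (IsRepeatedPlay P ℱ (gridUtility p (bertrandUtility (linearDemand α β γ) c)) U d pre act →
        (∀ i, IsMeanBased P ℱ U d pre act i) →
        ∀ᵐ ω ∂P,
          TimeAverageConverges (fun t => act t ω) {k.castSucc, k.succ} ∧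
          ∀ i a, a ≠ k.castSucc → a ≠ k.succ →
            Tendsto (fun t => mixedStrategy P ℱ act t i a ω) atTop (𝓝 0))) := by

  refine ⟨fun D hD hc h1 hgap => ?_, fun α β γ hγ hβ h0 k hk hk' => ?_⟩
  · have hel := iteratedElimination_standard hn hp hD hc h1 hgap
    refine ⟨isNashEquilibrium_iff_of_iteratedElimination_singleton hel
      (isNashEquilibrium_standard hn hp hD hc h1), fun h hmb => ?_⟩
    filter_upwards [h.ae_timeAverageConverges (hel.ae_tendsto_mixedStrategy h hmb),
      hel.ae_tendsto_symmetricPureProfile h hmb] with ω h2 h3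
    exact ⟨h2, h3⟩
  · have hel := iteratedElimination_linear hn hp hγ hβ k hk hk'
    have hq : 0 ≤ continuousNashPrice α β γ c :=
      (h0.trans (hp.monotone (Fin.zero_le _))).trans hk
    refine ⟨isPureNashOn_linear_iff hn hγ hβ hq, isNashEquilibrium_linear_or hn hp hγ hβ k hk hk',
      fun x hx i a ha => ?_, fun h hmb => ?_⟩
    · by_contra hcon
      exact ha (hel.nash_support hx i a (by simpa using hcon))
    · have hx := hel.ae_tendsto_mixedStrategy h hmb
      filter_upwards [h.ae_timeAverageConverges hx, hx] with ω h2 h3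
      exact ⟨h2, fun i a ha ha' => h3 i a (by simp [ha, ha'])⟩
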